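/- Conventions. A series $\sum_{n\ge 0}a_n$ of complex numbers is $(\mathrm B')$ summable (Borel summable) to $\beta$, written $\sum_{n\ge 0} a_n=\beta\ (\mathrm B')$, if $f(t)=\sum_{n\ge 0}\frac{a_n}{n!}t^n$ converges for every $t$ and $\lim_{\lambda\to\infty}\int_0^\lambda e^{-t}f(t)\,dt=\beta$. Let $\mathcal O(\mathbb C)$ be the space of entire functions with the topology of uniform convergence on compact sets, and let $\mathcal O'(\mathbb C)$, the space of analytic functionals, be its topological dual. For $g\in\mathcal O'(\mathbb C)$ let $\mu_n=\langle g,s^n\rangle$ ($n\ge 0$) be its moments; the power series $b(z)=\sum_{n\ge 0}\mu_nz^n$ has positive radius of convergence. Its singular points are the points $\zeta\in\mathbb C$ at which the analytic continuation of $b$ along the ray from $0$ through $\zeta$ meets its first singularity; that is, $b$ has an analytic continuation to a neighbourhood of the segment $[0,t\zeta]$ for every $0\le t<1$, but not to a neighbourhood of $[0,\zeta]$. The Borel polygon $\Pi(b)$ of $b$ (with base point $0$) is the set of all $z\in\mathbb C$ that lie, for every singular point $\zeta$, on the same side as $0$ of the line through $\zeta$ perpendicular to $[0,\zeta]$, i.e.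 $\operatorname{Re}(z\overline{\zeta})<|\zeta|^2$. The Borel polygon of $g$ is $$\Pi(g)=\{s\in\mathbb C\setminus\{0\}:\ 1/s\in\Pi(b)\}.$$ Theorem. Let $g\in\mathcal O'(\mathbb C)$. Then for every $s\in\operatorname{int}\Pi(g)$ the series $$G(s)=-\frac1{2\pi i}\sum_{n=0}^\infty\frac{\mu_n}{s^{n+1}}\quad(\mathrm B')$$ is $(\mathrm B')$ summable, and its sum $G$ is analytic in $\operatorname{int}\Pi(g)$. Moreover, for every $\varphi\in\mathcal O(\mathbb C)$, $$\langle g,\varphi\rangle=-\oint_{\mathsf C}G(s)\varphi(s)\,ds,$$ where $\mathsf C$ is any closed piecewise $C^1$ path contained in $\operatorname{int}\Pi(g)$ whose winding number about every point of $\mathbb C\setminus\operatorname{int}\Pi(g)$ is $1$. -/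

import Mathlib

open scoped ComplexConjugate Topology

/-- `∑ aₙ = β (B')`: the series `∑ (aₙ / n!) tⁿ` converges for every `t`, and
`∫₀^∞ e⁻ᵗ (∑ (aₙ / n!) tⁿ) dt = β` as an improper integral. -/
def HasBorelSum (a : ℕ → ℂ) (β : ℂ) : Prop :=
  (∀ t : ℂ, Summable fun n : ℕ => a n / (n.factorial : ℂ) * t ^ n) ∧
  Filter.Tendsto
    (fun x : ℝ => ∫ t in (0 : ℝ)..x,
      Complex.exp (-(t : ℂ)) * ∑' n : ℕ, a n / (n.factorial : ℂ) * (t : ℂ) ^ n)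
    Filter.atTop (𝓝 β)

/-- The space `𝒪(ℂ)` of entire functions, with the (compact-open) topology of uniform
convergence on compact sets, inherited from `C(ℂ, ℂ)`. -/
noncomputable def EntireFun : Submodule ℂ C(ℂ, ℂ) where
  carrier := {f | Differentiable ℂ f}
  add_mem' hf hg := Differentiable.add hf hg
  zero_mem' := differentiable_const (0 : ℂ)
  smul_mem' c _ hf := Differentiable.const_smul hf c

/-- The monomial `s ↦ sⁿ` as an entire function. -/
noncomputable def EntireFun.monomial (n : ℕ) : EntireFun :=
  ⟨⟨fun s => s ^ n, continuous_pow n⟩, differentiable_pow n⟩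

/-- The space `𝒪'(ℂ)` of analytic functionals: the topological dual of `𝒪(ℂ)`. -/
abbrev AnalyticFunctional := EntireFun →L[ℂ] ℂ

/-- The moments `μₙ = ⟨g, sⁿ⟩` of an analytic functional. -/
noncomputable def AnalyticFunctional.moment (g : AnalyticFunctional) (n : ℕ) : ℂ :=
  g (EntireFun.monomial n)

/-- The (Mittag-Leffler) star of the power series `b(z) = ∑ aₙ zⁿ`: the points `z` such that `b`
has an analytic continuation along the segment `[0, z]`, i.e. to a neighbourhood of it. -/
def mittagLefflerStar (a : ℕ → ℂ) : Set ℂ :=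
  {z | ∃ (U : Set ℂ) (F : ℂ → ℂ), IsOpen U ∧ segment ℝ 0 z ⊆ U ∧ DifferentiableOn ℂ F U ∧
    ∀ᶠ w in 𝓝 (0 : ℂ), HasSum (fun n : ℕ => a n * w ^ n) (F w)}

/-- The singular points of `b(z) = ∑ aₙ zⁿ` (a series with positive radius of convergence):
the points `ζ` where the analytic continuation of `b` along the ray from `0` through `ζ`
meets its first singularity. -/
def starSingularPoints (a : ℕ → ℂ) : Set ℂ :=
  {ζ | ζ ∉ mittagLefflerStar a ∧
    ∀ t : ℝ, 0 ≤ t → t < 1 → (t : ℂ) * ζ ∈ mittagLefflerStar a}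

/-- The Borel polygon `Π(b)`, with base point `0`, of a power series `b(z) = ∑ aₙ zⁿ` with positive
radius of convergence: the points that lie, for every singular point `ζ` of `b`, on the same side
as `0` of the line through `ζ` perpendicular to `[0, ζ]`. -/
def borelPolygon (a : ℕ → ℂ) : Set ℂ :=
  {z | ∀ ζ ∈ starSingularPoints a, (z * conj ζ).re < ‖ζ‖ ^ 2}

/-- The Borel polygon of an analytic functional: `Π(g) = {s : 1 / s ∈ Π(b)}`, where
`b(z) = ∑ μₙ zⁿ`. The point `s = 0`, where `1 / s` is not a complex number, does not belong to
it. -/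
def AnalyticFunctional.borelPolygon (g : AnalyticFunctional) : Set ℂ :=
  {s | s ≠ 0 ∧ s⁻¹ ∈ _root_.borelPolygon g.moment}

/-- A path in `ℂ` is piecewise `C¹` if its parameter interval has a finite partition such that the
path is `C¹`, up to the end points, on every closed interval between consecutive division points. -/
def IsPiecewiseC1 {x y : ℂ} (γ : Path x y) : Prop :=
  ∃ P : Finset ℝ, ∀ u v : ℝ, 0 ≤ u → u < v → v ≤ 1 → (∀ p ∈ P, p ∉ Set.Ioo u v) →
    ContDiffOn ℝ 1 γ.extend (Set.Icc u v)

/-- The complex line integral `∫_γ f(z) dz`. -/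
noncomputable def contourIntegral (f : ℂ → ℂ) {x y : ℂ} (γ : Path x y) : ℂ :=
  curveIntegral (fun z => ContinuousLinearMap.toSpanSingleton ℂ (f z)) γ

/-- The winding number `(2πi)⁻¹ ∮_γ dz / (z - w)` of a closed path `γ` around a point `w` that is
not on `γ`. -/
noncomputable def windingNumber {x : ℂ} (γ : Path x x) (w : ℂ) : ℂ :=
  (2 * Real.pi * Complex.I)⁻¹ * contourIntegral (fun z => (z - w)⁻¹) γ

/-! Continuing b(z) = ∑ μₙ zⁿ along segments from 0 gives one holomorphic function B on the star. A
point z lies in the Borel polygon only if the closed disc with diameter [0, z] lies in the star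
(Thales). By compactness a slightly larger concentric circle still bounds a disc in the star; it
encloses 0 and z, and Re(z/w) < 1 on it. Cauchy's formula makes μₙ zⁿ the mean of (z/w)ⁿ against
B(w) dw / (2πi w), so the Borel transform is a mean of exp(tz/w). Against e⁻ᵗ these decay, and
integrating in t gives the Cauchy integral of B at z (`hasBorelSum_integral`,
`hasBorelSum_of_mem_borelPolygon`).

Hence G(s) = -(2πi)⁻¹ s⁻¹ B(1/s), which is holomorphic. To integrate G(s) sⁿ, expand B to order n
with a holomorphic remainder r. Every term has a primitive except μₙ/s: the remainder contributes
r(1/s)/s², and r has a primitive on the convex interior of the polygon. The winding number about 0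
then yields -μₙ, with no general homological Cauchy theorem. Taylor expansion of φ, convergent in
𝒪(ℂ), passes from monomials to φ. -/

/-! ### The star and the Borel polygon. -/

section Star

variable {a : ℕ → ℂ}

/-- A thickened segment is convex; convex domains meet in connected sets, as the identity theorem
requires. -/
theorem exists_convex_of_mem_mittagLefflerStar {z : ℂ} (hz : z ∈ mittagLefflerStar a) :
    ∃ (U : Set ℂ) (F : ℂ → ℂ), IsOpen U ∧ Convex ℝ U ∧ 0 ∈ U ∧ z ∈ U ∧ DifferentiableOn ℂ F U ∧
      ∀ᶠ w in 𝓝 (0 : ℂ), HasSum (fun n : ℕ => a n * w ^ n) (F w) := by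
  obtain ⟨U, F, hU, hseg, hF, hsum⟩ := hz
  have hcomp : IsCompact (segment ℝ 0 z) := by
    rw [← convexHull_pair]
    exact (Set.toFinite _).isCompact_convexHull ℝ
  obtain ⟨δ, hδ, hsub⟩ := hcomp.exists_thickening_subset_open hU hseg
  have hself := Metric.self_subset_thickening hδ (segment ℝ 0 z)
  exact ⟨Metric.thickening δ (segment ℝ 0 z), F, Metric.isOpen_thickening,
    (convex_segment 0 z).thickening δ, hself (left_mem_segment ℝ 0 z),
    hself (right_mem_segment ℝ 0 z), hF.mono hsub, hsum⟩

theorem subset_mittagLefflerStar {U : Set ℂ} {F : ℂ → ℂ} (hU : IsOpen U) (hc : Convex ℝ U)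
    (h0 : 0 ∈ U) (hF : DifferentiableOn ℂ F U)
    (hsum : ∀ᶠ w in 𝓝 (0 : ℂ), HasSum (fun n : ℕ => a n * w ^ n) (F w)) :
    U ⊆ mittagLefflerStar a := fun _ hw =>
  ⟨U, F, hU, hc.segment_subset h0 hw, hF, hsum⟩

theorem isOpen_mittagLefflerStar : IsOpen (mittagLefflerStar a) := by
  refine isOpen_iff_mem_nhds.2 fun z hz => ?_
  obtain ⟨U, F, hU, hc, h0, hzU, hF, hsum⟩ := exists_convex_of_mem_mittagLefflerStar hz
  exact Filter.mem_of_superset (hU.mem_nhds hzU) (subset_mittagLefflerStar hU hc h0 hF hsum)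

theorem eqOn_inter_of_eventually_hasSum {U V : Set ℂ} {F H : ℂ → ℂ} (hU : IsOpen U)
    (hUc : Convex ℝ U) (hU0 : 0 ∈ U) (hF : DifferentiableOn ℂ F U) (hV : IsOpen V)
    (hVc : Convex ℝ V) (hV0 : 0 ∈ V) (hH : DifferentiableOn ℂ H V)
    (hFs : ∀ᶠ w in 𝓝 (0 : ℂ), HasSum (fun n : ℕ => a n * w ^ n) (F w))
    (hHs : ∀ᶠ w in 𝓝 (0 : ℂ), HasSum (fun n : ℕ => a n * w ^ n) (H w)) :
    Set.EqOn F H (U ∩ V) := by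
  have hUV := hU.inter hV
  refine ((hF.mono Set.inter_subset_left).analyticOnNhd hUV).eqOn_of_preconnected_of_eventuallyEq
    ((hH.mono Set.inter_subset_right).analyticOnNhd hUV) (hUc.inter hVc).isPreconnected
    ⟨hU0, hV0⟩ ?_
  filter_upwards [hFs, hHs] with w h₁ h₂ using h₁.unique h₂

/-- The local continuations agree on overlaps, so taking at each z the value of the one chosen for z
glues them. -/
theorem exists_continuation_mittagLefflerStar (h0 : (0 : ℂ) ∈ mittagLefflerStar a) :
    ∃ B : ℂ → ℂ, DifferentiableOn ℂ B (mittagLefflerStar a) ∧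
      ∀ᶠ w in 𝓝 (0 : ℂ), HasSum (fun n : ℕ => a n * w ^ n) (B w) := by
  classical
  choose U F hU hc hU0 hzU hF hsum using
    fun z : mittagLefflerStar a => exists_convex_of_mem_mittagLefflerStar z.2
  let B : ℂ → ℂ := fun z => if hz : z ∈ mittagLefflerStar a then F ⟨z, hz⟩ z else 0
  have key : ∀ z : mittagLefflerStar a, Set.EqOn B (F z) (U z) := by
    intro z w hw
    have hwS := subset_mittagLefflerStar (hU z) (hc z) (hU0 z) (hF z) (hsum z) hw
    simp only [B, dif_pos hwS]
    exact eqOn_inter_of_eventually_hasSum (hU _) (hc _) (hU0 _) (hF _) (hU _) (hc _) (hU0 _) (hF _)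
      (hsum _) (hsum _) ⟨hzU ⟨w, hwS⟩, hw⟩
  refine ⟨B, fun z hz => ?_, ?_⟩
  · refine DifferentiableAt.differentiableWithinAt ?_
    exact (((hF ⟨z, hz⟩).congr (key ⟨z, hz⟩)).differentiableAt ((hU ⟨z, hz⟩).mem_nhds (hzU ⟨z, hz⟩)))
  · filter_upwards [hsum ⟨0, h0⟩, (hU ⟨0, h0⟩).mem_nhds (hU0 ⟨0, h0⟩)] with w hw hwU
    rw [key _ hwU]
    exact hw

/-- On every ray through a point outside the star there is a first singular point. -/
theorem exists_smul_mem_starSingularPoints (h0 : (0 : ℂ) ∈ mittagLefflerStar a) {w : ℂ}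
    (hw : w ∉ mittagLefflerStar a) :
    ∃ t : ℝ, 0 < t ∧ t ≤ 1 ∧ (t : ℂ) * w ∈ starSingularPoints a := by
  let S : Set ℝ := Set.Icc 0 1 ∩ (fun t : ℝ => (t : ℂ) * w) ⁻¹' (mittagLefflerStar a)ᶜ
  have hS : IsCompact S := isCompact_Icc.inter_right
    (isOpen_mittagLefflerStar.isClosed_compl.preimage (by fun_prop))
  obtain ⟨t, ⟨⟨ht0, ht1⟩, htS⟩, hmin⟩ := hS.exists_isLeast ⟨1, by simp [S, hw]⟩
  have htpos : 0 < t := by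
    refine ht0.lt_of_ne ?_
    rintro rfl
    simp [h0] at htS
  refine ⟨t, htpos, ht1, htS, fun u hu0 hu1 => ?_⟩
  by_contra hcon
  have := hmin (show u * t ∈ S from
    ⟨⟨by positivity, by nlinarith⟩, by simpa [mul_assoc] using hcon⟩)
  nlinarith

/-- An intersection of half-planes. Convexity later provides a primitive of the Taylor remainder. -/
theorem convex_borelPolygon (a : ℕ → ℂ) : Convex ℝ (borelPolygon a) := by
  have : borelPolygon a = ⋂ ζ ∈ starSingularPoints a, {z | (z * conj ζ).re < ‖ζ‖ ^ 2} := by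
    ext z; simp [borelPolygon]
  rw [this]
  refine convex_iInter₂ fun ζ _ => convex_halfSpace_lt ⟨fun x y => ?_, fun c x => ?_⟩ _
  · simp [add_mul]
  · simp; ring

/-- The closed disc with diameter `[0, z]` is contained in the star if `z` lies in the Borel
polygon. -/
theorem mem_mittagLefflerStar_of_mem_borelPolygon (h0 : (0 : ℂ) ∈ mittagLefflerStar a) {z w : ℂ}
    (hz : z ∈ borelPolygon a) (hw : ‖w‖ ^ 2 ≤ (z * conj w).re) : w ∈ mittagLefflerStar a := by
  by_contra hcon
  obtain ⟨t, ht0, ht1, hζ⟩ := exists_smul_mem_starSingularPoints h0 hcon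
  have h := hz _ hζ
  have h1 : (z * conj ((t : ℂ) * w)).re = t * (z * conj w).re := by simp; ring
  have h2 : ‖(t : ℂ) * w‖ ^ 2 = t ^ 2 * ‖w‖ ^ 2 := by simp [mul_pow]
  rw [h1, h2] at h
  nlinarith [mul_le_mul_of_nonneg_left hw ht0.le, mul_nonneg (mul_nonneg ht0.le (sub_nonneg.2 ht1)) (sq_nonneg ‖w‖)]

/-- Thales' theorem as an identity: ‖w‖² ≤ Re(z w̄) exactly when w is in the closed disc with
diameter [0, z]. -/
theorem norm_sub_half_sq (z w : ℂ) :
    ‖w - z / 2‖ ^ 2 = ‖w‖ ^ 2 - (z * conj w).re + (‖z‖ / 2) ^ 2 := by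
  simp only [Complex.sq_norm, div_pow, Complex.normSq_apply]
  simp
  ring

theorem borelPolygon_subset_mittagLefflerStar (h0 : (0 : ℂ) ∈ mittagLefflerStar a) :
    borelPolygon a ⊆ mittagLefflerStar a := fun z hz =>
  mem_mittagLefflerStar_of_mem_borelPolygon h0 hz (by
    rw [Complex.mul_conj, Complex.ofReal_re, Complex.normSq_eq_norm_sq])

theorem exists_closedBall_subset_mittagLefflerStar (h0 : (0 : ℂ) ∈ mittagLefflerStar a) {z : ℂ}
    (hz : z ∈ borelPolygon a) :
    ∃ ρ : ℝ, ‖z‖ / 2 < ρ ∧ Metric.closedBall (z / 2) ρ ⊆ mittagLefflerStar a := by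
  have hsub : Metric.closedBall (z / 2) (‖z‖ / 2) ⊆ mittagLefflerStar a := by
    intro w hw
    refine mem_mittagLefflerStar_of_mem_borelPolygon h0 hz ?_
    rw [mem_closedBall_iff_norm] at hw
    have := norm_sub_half_sq z w
    have h2 := pow_le_pow_left₀ (norm_nonneg _) hw 2
    linarith
  obtain ⟨δ, hδ, h⟩ :=
    (isCompact_closedBall (z / 2) (‖z‖ / 2)).exists_cthickening_subset_open
      isOpen_mittagLefflerStar hsub
  rw [cthickening_closedBall hδ.le (by positivity)] at h
  exact ⟨_, by linarith, h⟩

/-- The inversion w ↦ z/w carries the exterior of the Thales disc into the half-plane Re < 1. -/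
theorem re_div_lt_one {z w : ℂ} (hw : ‖z‖ / 2 < ‖w - z / 2‖) : (z / w).re < 1 := by
  have h := norm_sub_half_sq z w
  have h2 : (‖z‖ / 2) ^ 2 < ‖w - z / 2‖ ^ 2 := pow_lt_pow_left₀ hw (by positivity) two_ne_zero
  have hw0 : w ≠ 0 := by
    rintro rfl
    simp at hw
  have h3 : (z / w).re = (z * conj w).re / ‖w‖ ^ 2 := by
    rw [Complex.div_re, Complex.sq_norm]
    simp
    ring
  rw [h3, div_lt_one (by positivity)]
  linarith

end Star

/-! ### Taylor remainders and Borel sums of moment sequences. -/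

/-- The remainder is the n-fold difference quotient at 0; removability of the singularity keeps it
holomorphic on all of U. -/
theorem exists_taylor_remainder {a : ℕ → ℂ} {U : Set ℂ} {B : ℂ → ℂ} (hU : U ∈ 𝓝 (0 : ℂ))
    (hB : DifferentiableOn ℂ B U)
    (hsum : ∀ᶠ w in 𝓝 (0 : ℂ), HasSum (fun n : ℕ => a n * w ^ n) (B w)) (n : ℕ) :
    ∃ r : ℂ → ℂ, DifferentiableOn ℂ r U ∧
      ∀ w, B w = ∑ k ∈ Finset.range n, a k * w ^ k + w ^ n * r w := by
  have hp : HasFPowerSeriesAt B (FormalMultilinearSeries.ofScalars ℂ a) 0 := by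
    rw [hasFPowerSeriesAt_iff]
    simpa [FormalMultilinearSeries.coeff_ofScalars, mul_comm] using hsum
  let r : ℕ → ℂ → ℂ := fun n => (Function.swap dslope 0)^[n] B
  have hr : ∀ n, r (n + 1) = dslope (r n) 0 := fun n => by
    simp only [r, Function.iterate_succ', Function.comp_apply, Function.swap]
  have h0 : ∀ n, r n 0 = a n := fun n => by
    have := (hp.has_fpower_series_iterate_dslope_fslope n).coeff_zero 1
    refine this.symm.trans ?_
    change (FormalMultilinearSeries.fslope^[n] (FormalMultilinearSeries.ofScalars ℂ a)).coeff 0 = _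
    simp [FormalMultilinearSeries.coeff_iterate_fslope, FormalMultilinearSeries.coeff_ofScalars]
  refine ⟨r n, ?_, fun w => ?_⟩
  · induction n with
    | zero => exact hB
    | succ n ih => rw [hr]; exact (Complex.differentiableOn_dslope hU).2 ih
  · induction n with
    | zero => simp [r]
    | succ n ih =>
      have := sub_smul_dslope (r n) 0 w
      rw [← hr, h0, sub_zero, smul_eq_mul] at this
      rw [ih, Finset.sum_range_succ, pow_succ, mul_assoc, this]
      ring

theorem HasBorelSum.const_mul {a : ℕ → ℂ} {β : ℂ} (h : HasBorelSum a β) (c : ℂ) :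
    HasBorelSum (fun n => c * a n) (c * β) := by
  have heq : ∀ (t : ℂ) (n : ℕ), c * a n / (n.factorial : ℂ) * t ^ n =
      c * (a n / (n.factorial : ℂ) * t ^ n) := fun t n => by ring
  refine ⟨fun t => by simpa only [heq] using (h.1 t).mul_left c, ?_⟩
  refine (h.2.const_mul c).congr fun x => ?_
  rw [← intervalIntegral.integral_const_mul]
  refine intervalIntegral.integral_congr fun t _ => ?_
  simp only [heq, tsum_mul_left]
  ring

section Moments

variable {h u : ℝ → ℂ} {p q : ℝ}

theorem hasSum_integral_mul_exp (hh : Continuous h) (hu : Continuous u) (t : ℂ) :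
    HasSum (fun n : ℕ => (∫ θ in p..q, h θ * u θ ^ n) / (n.factorial : ℂ) * t ^ n)
      (∫ θ in p..q, h θ * Complex.exp (u θ * t)) := by
  have hexp : ∀ θ, HasSum (fun n : ℕ => h θ * u θ ^ n / (n.factorial : ℂ) * t ^ n)
      (h θ * Complex.exp (u θ * t)) := fun θ => by
    have := (NormedSpace.expSeries_div_hasSum_exp (u θ * t)).mul_left (h θ)
    rw [← Complex.exp_eq_exp_ℂ] at this
    exact this.congr_fun fun n => by ring
  have hexpR : ∀ θ, HasSum (fun n : ℕ => ‖h θ‖ * (‖u θ‖ * ‖t‖) ^ n / (n.factorial : ℝ))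
      (‖h θ‖ * Real.exp (‖u θ‖ * ‖t‖)) := fun θ => by
    have := (NormedSpace.expSeries_div_hasSum_exp (‖u θ‖ * ‖t‖)).mul_left ‖h θ‖
    rw [← Real.exp_eq_exp_ℝ] at this
    exact this.congr_fun fun n => by ring
  have := intervalIntegral.hasSum_integral_of_dominated_convergence (μ := MeasureTheory.volume)
    (a := p) (b := q)
    (fun (n : ℕ) θ => ‖h θ‖ * (‖u θ‖ * ‖t‖) ^ n / (n.factorial : ℝ))
    (F := fun (n : ℕ) θ => h θ * u θ ^ n / (n.factorial : ℂ) * t ^ n)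
    (f := fun θ => h θ * Complex.exp (u θ * t))
    (fun n => by fun_prop)
    (fun n => .of_forall fun θ _ => by
      simp only [norm_mul, norm_div, norm_pow, Complex.norm_natCast]
      apply le_of_eq
      ring)
    (.of_forall fun θ _ => (hexpR θ).summable)
    (by
      simp only [fun θ => (hexpR θ).tsum_eq]
      exact Continuous.intervalIntegrable (by fun_prop) _ _)
    (.of_forall fun θ _ => hexp θ)
  refine this.congr_fun fun n => ?_
  rw [intervalIntegral.integral_mul_const, intervalIntegral.integral_div]

/-- A moment sequence `∫ h uⁿ` with `Re u < 1` is Borel summable to `∫ h / (1 - u)`. -/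
theorem hasBorelSum_integral (hh : Continuous h) (hu : Continuous u) (hu1 : ∀ θ, (u θ).re < 1) :
    HasBorelSum (fun n => ∫ θ in p..q, h θ * u θ ^ n) (∫ θ in p..q, h θ / (1 - u θ)) := by
  have hne : ∀ θ, 1 - u θ ≠ 0 := fun θ h0 => by
    have h1 : u θ = 1 := (sub_eq_zero.1 h0).symm
    have := hu1 θ
    simp [h1] at this
  have hcont : Continuous fun θ => h θ / (1 - u θ) := hh.div (by fun_prop) hne
  refine ⟨fun t => (hasSum_integral_mul_exp hh hu t).summable, ?_⟩
  have hval : ∀ x : ℝ, ∫ t in (0 : ℝ)..x, Complex.exp (-(t : ℂ)) *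
      ∑' n : ℕ, (∫ θ in p..q, h θ * u θ ^ n) / (n.factorial : ℂ) * (t : ℂ) ^ n =
      ∫ θ in p..q, h θ / (1 - u θ) * (1 - Complex.exp (-((1 - u θ) * x))) := by
    intro x
    have h1 : ∀ t : ℝ, Complex.exp (-(t : ℂ)) *
        ∑' n : ℕ, (∫ θ in p..q, h θ * u θ ^ n) / (n.factorial : ℂ) * (t : ℂ) ^ n =
        ∫ θ in p..q, h θ * Complex.exp (-(1 - u θ) * t) := fun t => by
      rw [(hasSum_integral_mul_exp hh hu t).tsum_eq, ← intervalIntegral.integral_const_mul]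
      refine intervalIntegral.integral_congr fun θ _ => ?_
      rw [mul_left_comm, ← Complex.exp_add]
      ring_nf
    simp only [h1]
    rw [MeasureTheory.intervalIntegral_intervalIntegral_swap]
    · refine intervalIntegral.integral_congr fun θ _ => ?_
      rw [intervalIntegral.integral_const_mul, integral_exp_mul_complex (neg_ne_zero.2 (hne θ))]
      have := hne θ
      simp only [Complex.ofReal_zero, mul_zero, Complex.exp_zero, neg_mul]
      field_simp
      ring
    · refine MeasureTheory.IntegrableOn.mono_set (ContinuousOn.integrableOn_compact
        (isCompact_uIcc.prod isCompact_uIcc) (Continuous.continuousOn ?_))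
        (Set.prod_mono Set.uIoc_subset_uIcc Set.uIoc_subset_uIcc)
      simp only [Function.uncurry_def]
      fun_prop
  simp only [hval]
  -- The factor 2 bounds |1 - exp(-(1 - u)x)| for x ≥ 0, since Re(1 - u) > 0.
  refine intervalIntegral.tendsto_integral_filter_of_dominated_convergence
    (fun θ => ‖h θ / (1 - u θ)‖ * 2) ?_ ?_ ?_ ?_
  · exact .of_forall fun x => Continuous.aestronglyMeasurable (by fun_prop)
  · filter_upwards [Filter.eventually_ge_atTop 0] with x hx
    refine .of_forall fun θ _ => ?_
    rw [norm_mul]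
    refine mul_le_mul_of_nonneg_left ((norm_sub_le _ _).trans ?_) (norm_nonneg _)
    have : ‖Complex.exp (-((1 - u θ) * x))‖ ≤ 1 := by
      rw [Complex.norm_exp, Real.exp_le_one_iff]
      simp
      nlinarith [hu1 θ]
    rw [norm_one]
    linarith
  · exact Continuous.intervalIntegrable (by fun_prop) _ _
  · refine .of_forall fun θ _ => ?_
    have : Filter.Tendsto (fun x : ℝ => Complex.exp (-((1 - u θ) * x))) Filter.atTop (𝓝 0) := by
      rw [tendsto_zero_iff_norm_tendsto_zero]
      simp only [Complex.norm_exp]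
      refine Real.tendsto_exp_atBot.comp ?_
      have := Filter.tendsto_id.const_mul_atTop_of_neg (β := ℝ) (show (u θ).re - 1 < 0 by linarith [hu1 θ])
      refine this.congr fun x => ?_
      simp
      ring
    simpa using (this.const_sub 1).const_mul (h θ / (1 - u θ))

end Moments

/-! ### Off-centre Cauchy formulas and Borel summability in the polygon. -/

/-- Cauchy's coefficient formula on a circle that need not be centred at the origin. -/
theorem circleIntegral_mul_inv_pow_succ {a : ℕ → ℂ} {B : ℂ → ℂ} {U : Set ℂ} {c : ℂ} {ρ : ℝ}
    (hU : IsOpen U) (hB : DifferentiableOn ℂ B U) (hsub : Metric.closedBall c ρ ⊆ U)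
    (h0 : (0 : ℂ) ∈ Metric.ball c ρ)
    (hsum : ∀ᶠ w in 𝓝 (0 : ℂ), HasSum (fun n : ℕ => a n * w ^ n) (B w)) (n : ℕ) :
    ∮ w in C(c, ρ), B w * (w ^ (n + 1))⁻¹ = 2 * Real.pi * Complex.I * a n := by
  have h0U : (0 : ℂ) ∈ U := hsub (Metric.ball_subset_closedBall h0)
  have hρ : 0 < ρ := Metric.pos_of_mem_ball h0
  obtain ⟨r, hr, hBr⟩ := exists_taylor_remainder (hU.mem_nhds h0U) hB hsum (n + 1)
  have hne : ∀ w ∈ Metric.sphere c ρ, w ≠ 0 := by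
    rintro w hw rfl
    rw [Metric.mem_ball] at h0
    rw [Metric.mem_sphere] at hw
    linarith
  -- For k < n the exponent k - (n + 1) is at most -2, so only the residue aₙ/w contributes; r is
  -- holomorphic inside.
  have h1 : ∮ w in C(c, ρ), B w * (w ^ (n + 1))⁻¹ = ∮ w in C(c, ρ),
      (∑ k ∈ Finset.range n, a k * (w - 0) ^ ((k : ℤ) - (n + 1)) + a n * (w - 0)⁻¹) + r w := by
    refine circleIntegral.integral_congr hρ.le fun w hw => ?_
    have hw0 := hne w hw
    rw [hBr, Finset.sum_range_succ, add_mul, add_mul, Finset.sum_mul]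
    congr 1
    · congr 1
      · refine Finset.sum_congr rfl fun k _ => ?_
        rw [sub_zero, zpow_sub₀ hw0, mul_assoc, div_eq_mul_inv]
        norm_cast
      · rw [sub_zero, pow_succ]; field_simp
    · field_simp
  have hci : ∀ k : ℕ, CircleIntegrable (fun w : ℂ => a k * (w - 0) ^ ((k : ℤ) - (n + 1))) c ρ :=
    fun k => ContinuousOn.circleIntegrable hρ.le
      (continuousOn_const.mul ((continuousOn_id.sub continuousOn_const).zpow₀ _ fun w hw => .inl (by simpa using hne w hw)))
  have hci2 : CircleIntegrable (fun w : ℂ => a n * (w - 0)⁻¹) c ρ :=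
    ContinuousOn.circleIntegrable hρ.le
      (continuousOn_const.mul ((continuousOn_id.sub continuousOn_const).inv₀ fun w hw => by simpa using hne w hw))
  have hci3 : CircleIntegrable (fun w : ℂ => ∑ k ∈ Finset.range n, a k * (w - 0) ^ ((k : ℤ) - (n + 1))) c ρ :=
    CircleIntegrable.fun_sum _ fun k _ => hci k
  have hci4 : CircleIntegrable r c ρ := ContinuousOn.circleIntegrable hρ.le
      (hr.continuousOn.mono (Metric.sphere_subset_closedBall.trans hsub))
  rw [h1, circleIntegral.integral_add (hci3.fun_add hci2) hci4, circleIntegral.integral_add hci3 hci2,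
    circleIntegral.integral_fun_sum fun k _ => hci k, circleIntegral.integral_const_mul,
    circleIntegral.integral_sub_inv_of_mem_ball h0]
  have h2 : ∮ w in C(c, ρ), r w = 0 :=
    Complex.circleIntegral_eq_zero_of_differentiable_on_off_countable hρ.le Set.countable_empty
      (hr.continuousOn.mono hsub) fun w hw =>
        hr.differentiableAt (hU.mem_nhds (hsub (Metric.ball_subset_closedBall hw.1)))
  rw [h2, Finset.sum_eq_zero fun k hk => ?_]
  · ring
  · rw [circleIntegral.integral_const_mul, circleIntegral.integral_sub_zpow_of_ne, mul_zero]
    have := Finset.mem_range.1 hk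
    lia

/-- A power series is Borel summable to its continuation at every point of its Borel polygon. -/
theorem hasBorelSum_of_mem_borelPolygon {a : ℕ → ℂ} {B : ℂ → ℂ}
    (h0 : (0 : ℂ) ∈ mittagLefflerStar a) (hB : DifferentiableOn ℂ B (mittagLefflerStar a))
    (hsum : ∀ᶠ w in 𝓝 (0 : ℂ), HasSum (fun n : ℕ => a n * w ^ n) (B w)) {z : ℂ}
    (hz : z ∈ borelPolygon a) : HasBorelSum (fun n => a n * z ^ n) (B z) := by
  obtain ⟨ρ, hρ, hsub⟩ := exists_closedBall_subset_mittagLefflerStar h0 hz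
  have hρ0 : 0 < ρ := lt_of_le_of_lt (by positivity) hρ
  have h0b : (0 : ℂ) ∈ Metric.ball (z / 2) ρ := by simpa [dist_eq_norm] using hρ
  have hzb : z ∈ Metric.ball (z / 2) ρ := by
    rw [Metric.mem_ball, dist_eq_norm, sub_half]
    simpa using hρ
  let w : ℝ → ℂ := circleMap (z / 2) ρ
  have hwc : Continuous w := continuous_circleMap _ _
  have hws : ∀ θ, w θ ∈ Metric.sphere (z / 2) ρ := circleMap_mem_sphere _ hρ0.le
  have hre : ∀ θ, (z / w θ).re < 1 := fun θ => by
    refine re_div_lt_one ?_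
    rw [← dist_eq_norm, Metric.mem_sphere.1 (hws θ)]
    exact hρ
  have hw0 : ∀ θ, w θ ≠ 0 := fun θ hθ => by
    have := Metric.mem_sphere.1 (hws θ)
    rw [hθ] at this
    have h2 := Metric.mem_ball.1 h0b
    linarith
  have hBw : Continuous fun θ => B (w θ) :=
    (hB.continuousOn.mono (Metric.sphere_subset_closedBall.trans hsub)).comp_continuous hwc hws
  -- The density of B(w) dw / (2πi w) in the circle parameter; its moments against z/w are aₙ zⁿ.
  let h : ℝ → ℂ := fun θ => (2 * Real.pi * Complex.I)⁻¹ * (deriv w θ * (B (w θ) * (w θ)⁻¹))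
  have hh : Continuous h := by
    have hdw : Continuous (deriv w) := by
      have : deriv w = fun θ => circleMap 0 ρ θ * Complex.I := by
        ext θ; simp [w, deriv_circleMap]
      rw [this]
      fun_prop
    exact continuous_const.mul (hdw.mul (hBw.mul (hwc.inv₀ hw0)))
  have hu : Continuous fun θ => z / w θ := continuous_const.div hwc hw0
  have main := hasBorelSum_integral (p := 0) (q := 2 * Real.pi) hh hu hre
  have hpi : (2 * Real.pi * Complex.I : ℂ) ≠ 0 := Complex.two_pi_I_ne_zero
  convert main using 1
  · ext n
    have := circleIntegral_mul_inv_pow_succ isOpen_mittagLefflerStar hB hsub h0b hsum n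
    rw [circleIntegral] at this
    have h2 : ∀ θ, h θ * (z / w θ) ^ n = ((2 * Real.pi * Complex.I)⁻¹ * z ^ n) *
        (deriv w θ • (B (w θ) * (w θ ^ (n + 1))⁻¹)) := fun θ => by
      have := hw0 θ
      simp only [h, smul_eq_mul, div_pow, pow_succ]
      field_simp
    simp only [h2]
    rw [intervalIntegral.integral_const_mul, this]
    field_simp
  · have := (hB.mono hsub).circleIntegral_sub_inv_smul hzb
    rw [circleIntegral] at this
    have h2 : ∀ θ, h θ / (1 - z / w θ) = (2 * Real.pi * Complex.I)⁻¹ *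
        (deriv w θ • ((w θ - z)⁻¹ • B (w θ))) := fun θ => by
      have h3 := hw0 θ
      have h4 : w θ - z ≠ 0 := fun hc => by
        have h5 := hre θ
        rw [← sub_eq_zero.1 hc, div_self h3] at h5
        simp at h5
      have h6 : 1 - z / w θ ≠ 0 := by
        rw [one_sub_div h3]; exact div_ne_zero h4 h3
      simp only [h, smul_eq_mul]
      field_simp
    simp only [h2]
    rw [intervalIntegral.integral_const_mul, this, smul_eq_mul, inv_mul_cancel_left₀ hpi]

/-! ### Integration along piecewise C¹ paths. -/

section Contour

variable {x y : ℂ} {γ : Path x y}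

theorem contourIntegral_eq_intervalIntegral (f : ℂ → ℂ) (γ : Path x y) :
    contourIntegral f γ =
      ∫ t in (0 : ℝ)..1, derivWithin γ.extend unitInterval t * f (γ.extend t) := by
  rw [contourIntegral, curveIntegral_def]
  simp only [curveIntegralFun_def, ContinuousLinearMap.toSpanSingleton_apply, smul_eq_mul]

theorem derivWithin_Icc_eq_deriv {f : ℝ → ℂ} {u v t : ℝ} (ht : t ∈ Set.Ioo u v) :
    derivWithin f (Set.Icc u v) t = deriv f t :=
  derivWithin_of_mem_nhds (Icc_mem_nhds ht.1 ht.2)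

/-- Induction on the number of division points inside the interval, cutting at one of them. -/
theorem IsPiecewiseC1.intervalIntegrable_derivWithin (hγ : IsPiecewiseC1 γ) :
    IntervalIntegrable (derivWithin γ.extend unitInterval) MeasureTheory.volume 0 1 := by
  obtain ⟨P, hP⟩ := hγ
  have key : ∀ (n : ℕ) (u v : ℝ), 0 ≤ u → u < v → v ≤ 1 →
      (P.filter (· ∈ Set.Ioo u v)).card = n →
      IntervalIntegrable (derivWithin γ.extend unitInterval) MeasureTheory.volume u v := by
    intro n
    induction n using Nat.strong_induction_on with
    | _ n ih =>
      intro u v hu huv hv hn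
      by_cases hp : ∃ p ∈ P, p ∈ Set.Ioo u v
      · obtain ⟨p, hpP, hpI⟩ := hp
        have hlt : ∀ u' v' : ℝ, u ≤ u' → v' ≤ v → p ∉ Set.Ioo u' v' →
            (P.filter (· ∈ Set.Ioo u' v')).card < n := by
          intro u' v' hu' hv' hpn
          rw [← hn]
          refine Finset.card_lt_card ((Finset.ssubset_iff_of_subset fun q hq => ?_).2
            ⟨p, by simp [hpP, hpI.1, hpI.2], by simpa [hpP] using hpn⟩)
          rw [Finset.mem_filter] at hq ⊢
          exact ⟨hq.1, Set.Ioo_subset_Ioo hu' hv' hq.2⟩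
        exact (ih _ (hlt u p le_rfl hpI.2.le (by simp)) u p hu hpI.1 (hpI.2.le.trans hv) rfl).trans
          (ih _ (hlt p v hpI.1.le le_rfl (by simp)) p v (hu.trans hpI.1.le) hpI.2 hv rfl)
      · push Not at hp
        have hC := hP u v hu huv hv hp
        have hcont := hC.continuousOn_derivWithin (uniqueDiffOn_Icc huv) le_rfl
        -- The derivatives within [u, v] and within [0, 1] may differ at a corner, so they are
        -- compared only on the open interval.
        refine (hcont.intervalIntegrable_of_Icc huv.le).congr_uIoo fun t ht => ?_
        rw [Set.uIoo_of_le huv.le] at ht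
        rw [derivWithin_Icc_eq_deriv ht,
          derivWithin_Icc_eq_deriv (Set.Ioo_subset_Ioo hu hv ht)]
  exact key _ 0 1 le_rfl one_pos le_rfl rfl

theorem IsPiecewiseC1.exists_hasDerivAt (hγ : IsPiecewiseC1 γ) :
    ∃ P : Set ℝ, P.Countable ∧ ∀ t ∈ Set.Ioo (0 : ℝ) 1 \ P,
      HasDerivAt γ.extend (derivWithin γ.extend unitInterval t) t := by
  obtain ⟨P, hP⟩ := hγ
  refine ⟨P, P.countable_toSet, fun t ht => ?_⟩
  have hnhds : (Set.Ioo 0 1 ∩ (P : Set ℝ)ᶜ) ∈ 𝓝 t :=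
    Filter.inter_mem (Ioo_mem_nhds ht.1.1 ht.1.2)
      (P.finite_toSet.isClosed.isOpen_compl.mem_nhds ht.2)
  obtain ⟨u, v, htuv, hsub, hI⟩ := exists_Icc_mem_subset_of_mem_nhds hnhds
  have hmem : t ∈ Set.Ioo u v := by rwa [← mem_interior_iff_mem_nhds, interior_Icc] at hsub
  have huv := hmem.1.trans hmem.2
  have hC := hP u v (hI (Set.left_mem_Icc.2 huv.le)).1.1.le huv
    (hI (Set.right_mem_Icc.2 huv.le)).1.2.le fun p hp hpI =>
      (hI (Set.Ioo_subset_Icc_self hpI)).2 hp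
  have hd := (hC.contDiffAt hsub).differentiableAt one_ne_zero
  rw [derivWithin_Icc_eq_deriv ht.1]
  exact hd.hasDerivAt

theorem IsPiecewiseC1.intervalIntegrable_mul (hγ : IsPiecewiseC1 γ) {f : ℂ → ℂ} {Ω : Set ℂ}
    (hf : ContinuousOn f Ω) (hΩ : Set.range γ ⊆ Ω) :
    IntervalIntegrable (fun t => derivWithin γ.extend unitInterval t * f (γ.extend t))
      MeasureTheory.volume 0 1 := by
  refine hγ.intervalIntegrable_derivWithin.mul_continuousOn
    (hf.comp γ.continuous_extend.continuousOn fun t _ => hΩ ?_)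
  rw [← γ.extend_range]
  exact Set.mem_range_self t

/-- The contour integral of a derivative around a closed path vanishes. -/
theorem IsPiecewiseC1.contourIntegral_deriv_eq_zero {γ : Path x x} (hγ : IsPiecewiseC1 γ)
    {F f : ℂ → ℂ} {Ω : Set ℂ} (hF : ∀ z ∈ Ω, HasDerivAt F (f z) z) (hf : ContinuousOn f Ω)
    (hΩ : Set.range γ ⊆ Ω) : contourIntegral f γ = 0 := by
  obtain ⟨P, hP, hd⟩ := hγ.exists_hasDerivAt
  have hmem : ∀ t, γ.extend t ∈ Ω := fun t => hΩ (by
    rw [← γ.extend_range]; exact Set.mem_range_self t)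
  have hFc : ContinuousOn F Ω := fun z hz => (hF z hz).continuousAt.continuousWithinAt
  have := MeasureTheory.integral_eq_of_hasDerivAt_off_countable_of_le
    (fun t => F (γ.extend t)) (fun t => derivWithin γ.extend unitInterval t * f (γ.extend t))
    zero_le_one hP ((hFc.comp_continuous γ.continuous_extend hmem).continuousOn)
    (fun t ht => by
      rw [mul_comm]
      exact (hF _ (hmem t)).comp t (hd t ht)) (hγ.intervalIntegrable_mul hf hΩ)
  rw [contourIntegral_eq_intervalIntegral, this]
  simp

theorem IsPiecewiseC1.contourIntegral_add (hγ : IsPiecewiseC1 γ) {f₁ f₂ : ℂ → ℂ} {Ω : Set ℂ}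
    (h₁ : ContinuousOn f₁ Ω) (h₂ : ContinuousOn f₂ Ω) (hΩ : Set.range γ ⊆ Ω) :
    contourIntegral (fun z => f₁ z + f₂ z) γ = contourIntegral f₁ γ + contourIntegral f₂ γ := by
  simp only [contourIntegral_eq_intervalIntegral, mul_add]
  exact intervalIntegral.integral_add (hγ.intervalIntegrable_mul h₁ hΩ)
    (hγ.intervalIntegrable_mul h₂ hΩ)

theorem contourIntegral_const_mul (c : ℂ) (f : ℂ → ℂ) (γ : Path x y) :
    contourIntegral (fun z => c * f z) γ = c * contourIntegral f γ := by
  simp only [contourIntegral_eq_intervalIntegral, mul_left_comm _ c]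
  exact intervalIntegral.integral_const_mul _ _

theorem contourIntegral_congr {f₁ f₂ : ℂ → ℂ} (h : ∀ z ∈ Set.range γ, f₁ z = f₂ z) :
    contourIntegral f₁ γ = contourIntegral f₂ γ := by
  simp only [contourIntegral_eq_intervalIntegral]
  refine intervalIntegral.integral_congr fun t _ => ?_
  rw [h _ (by rw [← γ.extend_range]; exact Set.mem_range_self t)]

/-- A power series that converges everywhere may be integrated termwise against a continuous
function along a piecewise `C¹` path. -/
theorem IsPiecewiseC1.hasSum_contourIntegral (hγ : IsPiecewiseC1 γ) {G φ : ℂ → ℂ} {c : ℕ → ℂ}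
    {Ω : Set ℂ} (hG : ContinuousOn G Ω) (hΩ : Set.range γ ⊆ Ω)
    (hφ : ∀ z, HasSum (fun n => c n * z ^ n) (φ z)) :
    HasSum (fun n => c n * contourIntegral (fun z => G z * z ^ n) γ)
      (contourIntegral (fun z => G z * φ z) γ) := by
  have hrange : ∀ t, γ.extend t ∈ Set.range γ := fun t => by
    rw [← γ.extend_range]; exact Set.mem_range_self t
  obtain ⟨R, hR⟩ := (isCompact_range γ.continuous).isBounded.exists_norm_le
  have hR0 : 0 ≤ R := (norm_nonneg _).trans (hR _ (hrange 0))
  have hs : Summable fun n => ‖c n‖ * R ^ n := by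
    simpa [abs_of_nonneg hR0] using (hφ R).summable.norm
  have hGi := hγ.intervalIntegrable_mul hG hΩ
  have hterm : ∀ n : ℕ, c n * contourIntegral (fun z => G z * z ^ n) γ =
      ∫ t in (0 : ℝ)..1, derivWithin γ.extend unitInterval t * G (γ.extend t) *
        (c n * γ.extend t ^ n) := fun n => by
    rw [contourIntegral_eq_intervalIntegral, ← intervalIntegral.integral_const_mul]
    refine intervalIntegral.integral_congr fun t _ => ?_
    ring
  have hlim : contourIntegral (fun z => G z * φ z) γ =
      ∫ t in (0 : ℝ)..1, derivWithin γ.extend unitInterval t * G (γ.extend t) *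
        φ (γ.extend t) := by
    simp only [contourIntegral_eq_intervalIntegral, mul_assoc]
  simp only [hterm, hlim]
  refine intervalIntegral.hasSum_integral_of_dominated_convergence
    (fun n t => ‖derivWithin γ.extend unitInterval t * G (γ.extend t)‖ * (‖c n‖ * R ^ n))
    (fun n => ?_) (fun n => .of_forall fun t _ => ?_) (.of_forall fun t _ => hs.mul_left _) ?_
    (.of_forall fun t _ => (hφ _).mul_left _)
  · have hc : Continuous fun t => c n * γ.extend t ^ n := by
      have := γ.continuous_extend
      fun_prop
    exact hGi.def'.aestronglyMeasurable.mul hc.aestronglyMeasurable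
  · rw [norm_mul, norm_mul (c n), norm_pow]
    gcongr
    exact hR _ (hrange t)
  · simp only [tsum_mul_left]
    exact hGi.norm.mul_const _

end Contour

/-! ### Analytic functionals and their moments. -/

section Functional

theorem EntireFun.hasSum_taylor (φ : EntireFun) (z : ℂ) :
    HasSum (fun n : ℕ => ((n.factorial : ℂ)⁻¹ * iteratedDeriv n (φ : C(ℂ, ℂ)) 0) * z ^ n)
      ((φ : C(ℂ, ℂ)) z) := by
  have hφ : Differentiable ℂ (φ : C(ℂ, ℂ)) := φ.2
  refine (Complex.hasSum_taylorSeries_of_entire hφ 0 z).congr_fun fun n => ?_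
  simp only [smul_eq_mul, sub_zero]
  ring

/-- The Taylor series of an entire function converges in `𝒪(ℂ)`. -/
theorem EntireFun.hasSum_smul_monomial (φ : EntireFun) :
    HasSum (fun n : ℕ => ((n.factorial : ℂ)⁻¹ * iteratedDeriv n (φ : C(ℂ, ℂ)) 0) •
      EntireFun.monomial n) φ := by
  rw [HasSum, tendsto_subtype_rng, ContinuousMap.tendsto_iff_forall_isCompact_tendstoUniformlyOn]
  intro K hK
  obtain ⟨R, hR⟩ := hK.isBounded.exists_norm_le
  have hs : Summable fun n : ℕ =>
      ‖(n.factorial : ℂ)⁻¹ * iteratedDeriv n (φ : C(ℂ, ℂ)) 0‖ * |R| ^ n := by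
    simpa using (EntireFun.hasSum_taylor φ R).summable.norm
  have := tendstoUniformlyOn_tsum hs (s := K)
    (f := fun n z => ((n.factorial : ℂ)⁻¹ * iteratedDeriv n (φ : C(ℂ, ℂ)) 0) * z ^ n)
    fun n z hz => by
      rw [norm_mul, norm_pow]
      gcongr
      exact (hR z hz).trans (le_abs_self R)
  simp only [fun z => (EntireFun.hasSum_taylor φ z).tsum_eq] at this
  refine this.congr (.of_forall fun s z _ => ?_)
  simp [EntireFun.monomial]

theorem AnalyticFunctional.hasSum_moment (g : AnalyticFunctional) (φ : EntireFun) :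
    HasSum (fun n : ℕ => ((n.factorial : ℂ)⁻¹ * iteratedDeriv n (φ : C(ℂ, ℂ)) 0) * g.moment n)
      (g φ) := by
  simpa [AnalyticFunctional.moment] using g.hasSum (EntireFun.hasSum_smul_monomial φ)

/-- Continuity at 0 bounds g on functions smaller than ε on some compact K, and |sⁿ| ≤ Rⁿ on K. -/
theorem AnalyticFunctional.exists_moment_bound (g : AnalyticFunctional) :
    ∃ C R : ℝ, 0 < R ∧ ∀ n, ‖g.moment n‖ ≤ C * R ^ n := by
  have hg : g ⁻¹' Metric.ball 0 1 ∈ 𝓝 (0 : EntireFun) :=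
    g.continuous.continuousAt.preimage_mem_nhds (by simpa using Metric.ball_mem_nhds (0 : ℂ) one_pos)
  rw [nhds_subtype_eq_comap, Filter.mem_comap] at hg
  obtain ⟨t, ht, htg⟩ := hg
  obtain ⟨⟨K, ε⟩, ⟨hK, hε⟩, hsub⟩ := (nhds_basis_uniformity
    (Metric.uniformity_basis_dist (α := ℂ)).compactConvergenceUniformity).mem_iff.1 ht
  obtain ⟨R, hR0, hR⟩ := hK.isBounded.exists_pos_norm_le
  refine ⟨2 / ε, R, hR0, fun n => ?_⟩
  -- Scaled so that c sⁿ is at most ε/2 on K, hence strictly below ε.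
  let c : ℝ := ε / (2 * R ^ n)
  have hc : 0 < c := by positivity
  have hmem : (c : ℂ) • EntireFun.monomial n ∈ g ⁻¹' Metric.ball 0 1 := by
    refine htg (hsub fun x hx => ?_)
    have : ‖(c : ℂ) * x ^ n‖ < ε := by
      rw [norm_mul, norm_pow, Complex.norm_real, Real.norm_of_nonneg hc.le]
      calc c * ‖x‖ ^ n ≤ c * R ^ n := by gcongr; exact hR x hx
        _ = ε / 2 := by simp only [c]; field_simp
        _ < ε := by linarith
    simpa [EntireFun.monomial, dist_eq_norm] using this
  have h1 : c * ‖g.moment n‖ < 1 := by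
    simpa [AnalyticFunctional.moment, abs_of_pos hc] using hmem
  rw [← lt_div_iff₀' hc] at h1
  refine h1.le.trans_eq ?_
  simp only [c]
  field_simp

theorem AnalyticFunctional.zero_mem_mittagLefflerStar (g : AnalyticFunctional) :
    (0 : ℂ) ∈ mittagLefflerStar g.moment := by
  obtain ⟨C, R, hR, hC⟩ := g.exists_moment_bound
  let p := FormalMultilinearSeries.ofScalars ℂ g.moment
  have hrad : (((⟨R, hR.le⟩ : NNReal)⁻¹ : NNReal) : ENNReal) ≤ p.radius :=
    p.le_radius_of_bound C fun n => by
      rw [FormalMultilinearSeries.ofScalars_norm]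
      have : ((((⟨R, hR.le⟩ : NNReal)⁻¹ : NNReal)) : ℝ) = R⁻¹ := rfl
      rw [this, inv_pow, ← div_eq_mul_inv, div_le_iff₀ (by positivity)]
      exact hC n
  have hpos : 0 < p.radius := lt_of_lt_of_le (by
    rw [ENNReal.coe_pos]
    exact inv_pos.2 (show (0 : NNReal) < ⟨R, hR.le⟩ from hR)) hrad
  have hp := p.hasFPowerSeriesOnBall hpos
  obtain ⟨δ, hδ, han⟩ := hp.analyticAt.exists_ball_analyticOnNhd
  have hsum := hasFPowerSeriesAt_iff.1 hp.hasFPowerSeriesAt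
  refine subset_mittagLefflerStar Metric.isOpen_ball (convex_ball 0 δ) (Metric.mem_ball_self hδ)
    han.differentiableOn ?_ (Metric.mem_ball_self hδ)
  simpa [p, FormalMultilinearSeries.coeff_ofScalars, mul_comm] using hsum

end Functional

/-! ### The Cauchy transform and its contour integrals. -/

theorem inv_mem_interior_borelPolygon {g : AnalyticFunctional} {s : ℂ}
    (hs : s ∈ interior g.borelPolygon) : s⁻¹ ∈ interior (borelPolygon g.moment) := by
  have hs0 : s ≠ 0 := (interior_subset hs).1
  have hopen : IsOpen ({0}ᶜ ∩ Inv.inv ⁻¹' interior g.borelPolygon) :=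
    (continuousOn_inv₀ (G₀ := ℂ)).isOpen_inter_preimage isOpen_compl_singleton isOpen_interior
  refine mem_interior.2 ⟨_, fun w hw => ?_, hopen, by simpa using hs0, by simpa using hs⟩
  simpa using (interior_subset hw.2).2

/-- The sum of the series `-(2πi)⁻¹ ∑ μₙ / sⁿ⁺¹`, expressed through a continuation `B` of
`∑ μₙ zⁿ`. -/
noncomputable def cauchyTransformOf (B : ℂ → ℂ) (s : ℂ) : ℂ :=
  -(1 / (2 * (Real.pi : ℂ) * Complex.I)) * (s⁻¹ * B s⁻¹)

section CauchyTransform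

variable {g : AnalyticFunctional} {B : ℂ → ℂ}

theorem hasBorelSum_cauchyTransformOf (hB : DifferentiableOn ℂ B (mittagLefflerStar g.moment))
    (hsum : ∀ᶠ w in 𝓝 (0 : ℂ), HasSum (fun n : ℕ => g.moment n * w ^ n) (B w)) {s : ℂ}
    (hs : s ∈ g.borelPolygon) :
    HasBorelSum (fun n : ℕ => -(1 / (2 * (Real.pi : ℂ) * Complex.I)) *
      (g.moment n / s ^ (n + 1))) (cauchyTransformOf B s) := by
  have := ((hasBorelSum_of_mem_borelPolygon g.zero_mem_mittagLefflerStar hB hsum hs.2).const_mul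
    s⁻¹).const_mul (-(1 / (2 * (Real.pi : ℂ) * Complex.I)))
  convert this using 1
  · ext n
    rw [div_eq_mul_inv, pow_succ, mul_inv, inv_pow]
    ring
  · rfl

theorem differentiableOn_cauchyTransformOf
    (hB : DifferentiableOn ℂ B (mittagLefflerStar g.moment)) :
    DifferentiableOn ℂ (cauchyTransformOf B) (interior g.borelPolygon) := by
  have hinv : DifferentiableOn ℂ (fun s : ℂ => s⁻¹) (interior g.borelPolygon) :=
    differentiableOn_inv.mono fun s hs => (interior_subset hs).1
  exact (hinv.mul (hB.comp hinv fun s hs => borelPolygon_subset_mittagLefflerStar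
    g.zero_mem_mittagLefflerStar (interior_subset hs).2)).const_mul _

theorem contourIntegral_cauchyTransformOf_mul_pow
    (hB : DifferentiableOn ℂ B (mittagLefflerStar g.moment))
    (hsum : ∀ᶠ w in 𝓝 (0 : ℂ), HasSum (fun n : ℕ => g.moment n * w ^ n) (B w)) {x : ℂ}
    {γ : Path x x} (hγ : IsPiecewiseC1 γ) (hΩ : Set.range γ ⊆ interior g.borelPolygon)
    (hw : windingNumber γ 0 = 1) (n : ℕ) :
    contourIntegral (fun s => cauchyTransformOf B s * s ^ n) γ = -g.moment n := by
  have h0 := g.zero_mem_mittagLefflerStar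
  obtain ⟨r, hr, hBr⟩ :=
    exists_taylor_remainder (isOpen_mittagLefflerStar.mem_nhds h0) hB hsum (n + 1)
  have hsub : interior (borelPolygon g.moment) ⊆ mittagLefflerStar g.moment :=
    interior_subset.trans (borelPolygon_subset_mittagLefflerStar h0)
  -- Q is a primitive of r, available because the domain is convex.
  obtain ⟨Q, hQ⟩ := (convex_borelPolygon g.moment).interior.exists_forall_hasDerivWithinAt
    (hr.mono hsub)
  have hne : ∀ s ∈ interior g.borelPolygon, s ≠ 0 := fun s hs => (interior_subset hs).1
  -- What remains of sⁿ⁻¹ B(1/s) after removing μₙ/s. As k < n, the natural subtraction does not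
  -- truncate.
  let q : ℂ → ℂ := fun s =>
    ∑ k ∈ Finset.range n, g.moment k * s ^ (n - 1 - k) + (s ^ 2)⁻¹ * r s⁻¹
  have hinv : ContinuousOn (fun s : ℂ => s⁻¹) (interior g.borelPolygon) :=
    continuousOn_inv₀.mono hne
  have hq : ContinuousOn q (interior g.borelPolygon) := by
    refine ContinuousOn.add (by fun_prop) (ContinuousOn.mul ?_ ?_)
    · exact (by fun_prop : ContinuousOn (fun s : ℂ => s ^ 2) _).inv₀ fun s hs =>
        pow_ne_zero 2 (hne s hs)
    · exact hr.continuousOn.comp hinv fun s hs => hsub (inv_mem_interior_borelPolygon hs)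
  have hprim : ∀ s ∈ interior g.borelPolygon, HasDerivAt
      (fun s => ∑ k ∈ Finset.range n, g.moment k * (s ^ (n - 1 - k + 1) / ((n - 1 - k : ℕ) + 1))
        - Q s⁻¹) (q s) s := by
    intro s hs
    have hQs := (hQ _ (inv_mem_interior_borelPolygon hs)).hasDerivAt
      (isOpen_interior.mem_nhds (inv_mem_interior_borelPolygon hs))
    have h1 := hQs.comp s (hasDerivAt_inv (hne s hs))
    have h2 : HasDerivAt (fun s : ℂ => ∑ k ∈ Finset.range n,
        g.moment k * (s ^ (n - 1 - k + 1) / ((n - 1 - k : ℕ) + 1)))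
        (∑ k ∈ Finset.range n, g.moment k * s ^ (n - 1 - k)) s := by
      refine HasDerivAt.fun_sum fun k _ => HasDerivAt.const_mul _ ?_
      have h3 := (hasDerivAt_pow (n - 1 - k + 1) s).div_const (((n - 1 - k : ℕ) : ℂ) + 1)
      have h4 : (((n - 1 - k : ℕ) : ℂ) + 1) ≠ 0 := Nat.cast_add_one_ne_zero _
      refine h3.congr_deriv ?_
      push_cast
      rw [mul_div_cancel_left₀ _ h4]
    refine (h2.sub h1).congr_deriv ?_
    simp only [q]
    ring
  have hpi : (2 * Real.pi * Complex.I : ℂ) ≠ 0 := Complex.two_pi_I_ne_zero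
  have hsplit : ∀ s ∈ Set.range γ, cauchyTransformOf B s * s ^ n =
      -(1 / (2 * (Real.pi : ℂ) * Complex.I)) * (g.moment n * (s - 0)⁻¹ + q s) := by
    intro s hs
    have hs0 := hne s (hΩ hs)
    have hsumk : ∑ k ∈ Finset.range n, g.moment k * s ^ (n - 1 - k) =
        s⁻¹ * (∑ k ∈ Finset.range n, g.moment k * s⁻¹ ^ k) * s ^ n := by
      rw [mul_assoc, Finset.sum_mul, Finset.mul_sum]
      refine Finset.sum_congr rfl fun k hk => ?_
      obtain ⟨m, rfl⟩ : ∃ m, n = m + k + 1 := ⟨n - 1 - k, by have := Finset.mem_range.1 hk; lia⟩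
      have : m + k + 1 - 1 - k = m := by lia
      rw [this, inv_pow, pow_succ, pow_add]
      field_simp
    simp only [cauchyTransformOf, q, hsumk, sub_zero]
    rw [hBr, Finset.sum_range_succ, mul_assoc]
    congr 1
    simp only [inv_pow]
    field_simp
    ring
  rw [contourIntegral_congr hsplit, contourIntegral_const_mul, hγ.contourIntegral_add
    (Ω := interior g.borelPolygon) (by simpa using continuousOn_const.fun_mul hinv) hq hΩ,
    contourIntegral_const_mul, hγ.contourIntegral_deriv_eq_zero hprim hq hΩ]
  rw [windingNumber, inv_mul_eq_iff_eq_mul₀ hpi] at hw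
  rw [hw]
  field_simp
  ring

end CauchyTransform

theorem mainTheorem4 (g : AnalyticFunctional) :
    ∃ G : ℂ → ℂ,
      (∀ s ∈ interior g.borelPolygon,
        HasBorelSum
          (fun n : ℕ => -(1 / (2 * (Real.pi : ℂ) * Complex.I)) * (g.moment n / s ^ (n + 1)))
          (G s)) ∧
      AnalyticOnNhd ℂ G (interior g.borelPolygon) ∧
      ∀ (φ : EntireFun) (x : ℂ) (γ : Path x x),
        IsPiecewiseC1 γ →
        Set.range γ ⊆ interior g.borelPolygon →
        (∀ w ∈ (interior g.borelPolygon)ᶜ, windingNumber γ w = 1) →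
        g φ = -contourIntegral (fun s => G s * (φ : C(ℂ, ℂ)) s) γ := by
  obtain ⟨B, hB, hsum⟩ := exists_continuation_mittagLefflerStar g.zero_mem_mittagLefflerStar
  have hG := differentiableOn_cauchyTransformOf hB
  refine ⟨cauchyTransformOf B, fun s hs => hasBorelSum_cauchyTransformOf hB hsum
    (interior_subset hs), hG.analyticOnNhd isOpen_interior, fun φ x γ hγ hΩ hw => ?_⟩
  -- The polygon of g omits 0, so the path winds once around it.
  have h0 : (0 : ℂ) ∈ (interior g.borelPolygon)ᶜ := fun h => (interior_subset h).1 rfl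
  have h1 := hγ.hasSum_contourIntegral hG.continuousOn hΩ
    (EntireFun.hasSum_taylor φ)
  simp only [contourIntegral_cauchyTransformOf_mul_pow hB hsum hγ hΩ (hw 0 h0), mul_neg] at h1
  rw [h1.unique (g.hasSum_moment φ).neg, neg_neg]
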